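/- Let $0<T<\infty$, let $n_x,n_w,n_v,n_e,m\ge 0$ be integers, and write $\mathbb S^n$ for the real symmetric $n\times n$ matrices. For $t\in[0,T]$ let $A(t)\in\mathbb R^{n_x\times n_x}$, $B(t)\in\mathbb R^{n_x\times n_w}$, $C_v(t)\in\mathbb R^{n_v\times n_x}$, $D_{vw}(t)\in\mathbb R^{n_v\times n_w}$, $C_e(t)\in\mathbb R^{n_e\times n_x}$, $D_{ew}(t)\in\mathbb R^{n_e\times n_w}$, $\bar v(t)\in\mathbb R^{n_v}$ be given, and let $M_1,\dots,M_m\in\mathbb S^{n_v+n_w}$. Define $$A_a=\begin{bmatrix}A&0\\0&0\end{bmatrix}\in\mathbb R^{(n_x+1)\times(n_x+1)},\quad B_a=\begin{bmatrix}B\\0\end{bmatrix},\quad C_{v,a}=\begin{bmatrix}C_v&\bar v\end{bmatrix},\quad C_{e,a}=\begin{bmatrix}C_e&0\end{bmatrix},$$ and, for $\lambda\in\mathbb R^m$, $$\begin{bmatrix}Q&S\\S^\top&R\end{bmatrix}(t,\lambda)=\begin{bmatrix}C_{e,a}&D_{ew}\end{bmatrix}^\top\begin{bmatrix}C_{e,a}&D_{ew}\end{bmatrix}+\sum_{i=1}^m\lambda_i\begin{bmatrix}C_{v,a}&D_{vw}\\0&I\end{bmatrix}^\top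 M_i\begin{bmatrix}C_{v,a}&D_{vw}\\0&I\end{bmatrix},$$ with $Q$ of size $(n_x+1)\times(n_x+1)$. For differentiable $P,Y:[0,T]\to\mathbb S^{n_x+1}$ (one-sided derivatives at the end points) put $$DLMI(t,P,\lambda)=\begin{bmatrix}\dot P+A_a^\top P+PA_a&PB_a\\B_a^\top P&0\end{bmatrix}+\begin{bmatrix}Q&S\\S^\top&R\end{bmatrix},$$ $$RDE(t,Y,\lambda)=\dot Y+A_a^\top Y+YA_a+Q-(YB_a+S)R^{-1}(YB_a+S)^\top .$$ Let $e=\begin{bmatrix}0\\1\end{bmatrix}\in\mathbb R^{n_x+1}$ and $$J(\lambda)=\inf\{\,e^\top P(0)\,e:\ P:[0,T]\to\mathbb S^{n_x+1}\text{ differentiable},\ P(T)\succeq0,\ DLMI(t,P,\lambda)\prec0\ \ \forall t\in[0,T]\,\},$$ with $J(\lambda)=+\infty$ if there is no such $P$, and let $\mathcal D=\{\lambda\in\mathbb R^m: J(\lambda)<\infty\}$. Theorem 2. Let $\lambda\in\mathbb R^m$ be given. Assume that $A_a$, $B_a$, $Q(\cdot,\lambda)$, $R(\cdot,\lambda)$,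 $S(\cdot,\lambda)$ are continuous on $[0,T]$ and that $R(t,\lambda)\prec0$ for all $t\in[0,T]$. Then the following are equivalent: 1. $\lambda\in\mathcal D$, i.e. $J(\lambda)<\infty$. 2. There exists a differentiable function $P:[0,T]\to\mathbb S^{n_x+1}$ with $P(T)\succeq0$ and $DLMI(t,P,\lambda)\prec0$ for all $t\in[0,T]$. 3. There exists a differentiable function $Y:[0,T]\to\mathbb S^{n_x+1}$ with $Y(T)=0$ and $RDE(t,Y,\lambda)=0$ for all $t\in[0,T]$. Moreover, if these conditions hold, then $J(\lambda)=e^\top Y(0)\,e$ for every function $Y$ as in condition 3. -/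

import Mathlib

open Matrix Set

noncomputable section

/-- Data of the linear time-varying system
`δx' = A δx + B w`, `δv = Cv δx + Dvw w`, `δe = Ce δx + Dew w`
together with the nominal signal `vbar` that is added to `δv`. Only the values at times
`t ∈ [0, T]` are ever used. -/
structure LTVSystem (nx nw nv ne : ℕ) where
  A : ℝ → Matrix (Fin nx) (Fin nx) ℝ
  B : ℝ → Matrix (Fin nx) (Fin nw) ℝ
  Cv : ℝ → Matrix (Fin nv) (Fin nx) ℝ
  Dvw : ℝ → Matrix (Fin nv) (Fin nw) ℝ
  Ce : ℝ → Matrix (Fin ne) (Fin nx) ℝ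
  Dew : ℝ → Matrix (Fin ne) (Fin nw) ℝ
  vbar : ℝ → Fin nv → ℝ

/-- Index type of the augmented state `x_a = [δx; 1]`, of dimension `nx + 1`. -/
abbrev AugIdx (nx : ℕ) : Type := Fin nx ⊕ Fin 1

/-- The initial augmented state `[0; 1]`. -/
def augInit (nx : ℕ) : AugIdx nx → ℝ := Sum.elim (fun _ => 0) (fun _ => 1)

/-- A (symmetric) real matrix is negative definite. -/
def NegDef {n : Type*} (X : Matrix n n ℝ) : Prop := (-X).PosDef

namespace LTVSystem

variable {nx nw nv ne m : ℕ}

/-- `A_a = [A 0; 0 0]`. -/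
def Aa (G : LTVSystem nx nw nv ne) (t : ℝ) : Matrix (AugIdx nx) (AugIdx nx) ℝ :=
  fromBlocks (G.A t) 0 0 0

/-- `B_a = [B; 0]`. -/
def Ba (G : LTVSystem nx nw nv ne) (t : ℝ) : Matrix (AugIdx nx) (Fin nw) ℝ :=
  fromRows (G.B t) 0

/-- `C_{v,a} = [Cv vbar]`. -/
def Cva (G : LTVSystem nx nw nv ne) (t : ℝ) : Matrix (Fin nv) (AugIdx nx) ℝ :=
  fromCols (G.Cv t) (replicateCol (Fin 1) (G.vbar t))

/-- `C_{e,a} = [Ce 0]`. -/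
def Cea (G : LTVSystem nx nw nv ne) (t : ℝ) : Matrix (Fin ne) (AugIdx nx) ℝ :=
  fromCols (G.Ce t) 0

/-- `[C_{e,a} Dew]`, which maps `(x_a, w)` to `δe`. -/
def errOut (G : LTVSystem nx nw nv ne) (t : ℝ) :
    Matrix (Fin ne) (AugIdx nx ⊕ Fin nw) ℝ :=
  fromCols (G.Cea t) (G.Dew t)

/-- `[C_{v,a} Dvw; 0 I]`, which maps `(x_a, w)` to `(v, w)`. -/
def iqcOut (G : LTVSystem nx nw nv ne) (t : ℝ) :
    Matrix (Fin nv ⊕ Fin nw) (AugIdx nx ⊕ Fin nw) ℝ :=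
  fromBlocks (G.Cva t) (G.Dvw t) 0 1

/-- The matrix `[Q S; Sᵀ R]` at `(t, lam)`. -/
def QSR (G : LTVSystem nx nw nv ne)
    (M : Fin m → Matrix (Fin nv ⊕ Fin nw) (Fin nv ⊕ Fin nw) ℝ)
    (t : ℝ) (lam : Fin m → ℝ) : Matrix (AugIdx nx ⊕ Fin nw) (AugIdx nx ⊕ Fin nw) ℝ :=
  (G.errOut t)ᵀ * G.errOut t + ∑ i, lam i • ((G.iqcOut t)ᵀ * M i * G.iqcOut t)

/-- The block `Q(t, lam)`. -/
def Q (G : LTVSystem nx nw nv ne)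
    (M : Fin m → Matrix (Fin nv ⊕ Fin nw) (Fin nv ⊕ Fin nw) ℝ)
    (t : ℝ) (lam : Fin m → ℝ) : Matrix (AugIdx nx) (AugIdx nx) ℝ :=
  (G.QSR M t lam).toBlocks₁₁

/-- The block `S(t, lam)`. -/
def S (G : LTVSystem nx nw nv ne)
    (M : Fin m → Matrix (Fin nv ⊕ Fin nw) (Fin nv ⊕ Fin nw) ℝ)
    (t : ℝ) (lam : Fin m → ℝ) : Matrix (AugIdx nx) (Fin nw) ℝ :=
  (G.QSR M t lam).toBlocks₁₂

/-- The block `R(t, lam)`. -/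
def R (G : LTVSystem nx nw nv ne)
    (M : Fin m → Matrix (Fin nv ⊕ Fin nw) (Fin nv ⊕ Fin nw) ℝ)
    (t : ℝ) (lam : Fin m → ℝ) : Matrix (Fin nw) (Fin nw) ℝ :=
  (G.QSR M t lam).toBlocks₂₂

end LTVSystem

/-- `P : [0,T] → 𝕊^{nx+1}` is a differentiable function (one-sidedly at the end points). -/
def IsDiffSymm {nx : ℕ} (T : ℝ) (P : ℝ → Matrix (AugIdx nx) (AugIdx nx) ℝ) : Prop :=
  (∀ t ∈ Icc 0 T, (P t).IsSymm) ∧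
    ∀ i j, DifferentiableOn ℝ (fun t => P t i j) (Icc 0 T)

/-- The entrywise time derivative on `[0,T]`. -/
def timeDeriv {nx : ℕ} (T : ℝ) (P : ℝ → Matrix (AugIdx nx) (AugIdx nx) ℝ) (t : ℝ) :
    Matrix (AugIdx nx) (AugIdx nx) ℝ :=
  Matrix.of fun i j => derivWithin (fun s => P s i j) (Icc 0 T) t

namespace LTVSystem

variable {nx nw nv ne m : ℕ}

/-- The left-hand side `DLMI(t, P, lam)` of the differential linear matrix inequality. -/
def DLMI (G : LTVSystem nx nw nv ne)
    (M : Fin m → Matrix (Fin nv ⊕ Fin nw) (Fin nv ⊕ Fin nw) ℝ) (T : ℝ)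
    (t : ℝ) (P : ℝ → Matrix (AugIdx nx) (AugIdx nx) ℝ) (lam : Fin m → ℝ) :
    Matrix (AugIdx nx ⊕ Fin nw) (AugIdx nx ⊕ Fin nw) ℝ :=
  fromBlocks (timeDeriv T P t + (G.Aa t)ᵀ * P t + P t * G.Aa t) (P t * G.Ba t)
      ((G.Ba t)ᵀ * P t) 0
    + (G.errOut t)ᵀ * G.errOut t
    + ∑ i, lam i • ((G.iqcOut t)ᵀ * M i * G.iqcOut t)

/-- The left-hand side `RDE(t, Y, lam)` of the Riccati differential equation. -/
def RDE (G : LTVSystem nx nw nv ne)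
    (M : Fin m → Matrix (Fin nv ⊕ Fin nw) (Fin nv ⊕ Fin nw) ℝ) (T : ℝ)
    (t : ℝ) (Y : ℝ → Matrix (AugIdx nx) (AugIdx nx) ℝ) (lam : Fin m → ℝ) :
    Matrix (AugIdx nx) (AugIdx nx) ℝ :=
  timeDeriv T Y t + (G.Aa t)ᵀ * Y t + Y t * G.Aa t + G.Q M t lam
    - (Y t * G.Ba t + G.S M t lam) * (G.R M t lam)⁻¹ * (Y t * G.Ba t + G.S M t lam)ᵀ

/-- `P` is feasible for the optimization that defines `J(lam)`. -/
def Feasible (G : LTVSystem nx nw nv ne)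
    (M : Fin m → Matrix (Fin nv ⊕ Fin nw) (Fin nv ⊕ Fin nw) ℝ) (T : ℝ)
    (lam : Fin m → ℝ) (P : ℝ → Matrix (AugIdx nx) (AugIdx nx) ℝ) : Prop :=
  IsDiffSymm T P ∧ (P T).PosSemidef ∧ ∀ t ∈ Icc 0 T, NegDef (G.DLMI M T t P lam)

/-- `J(lam)`: the optimal (infimal) value of `[0;1]ᵀ P(0) [0;1]` over all feasible `P`.
It is `+∞` if there is no feasible `P`. -/
def J (G : LTVSystem nx nw nv ne)
    (M : Fin m → Matrix (Fin nv ⊕ Fin nw) (Fin nv ⊕ Fin nw) ℝ) (T : ℝ)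
    (lam : Fin m → ℝ) : EReal :=
  ⨅ (P : ℝ → Matrix (AugIdx nx) (AugIdx nx) ℝ) (_ : G.Feasible M T lam P),
    ((augInit nx ⬝ᵥ (P 0 *ᵥ augInit nx) : ℝ) : EReal)

/-- The domain of `J`. -/
def domJ (G : LTVSystem nx nw nv ne)
    (M : Fin m → Matrix (Fin nv ⊕ Fin nw) (Fin nv ⊕ Fin nw) ℝ) (T : ℝ) :
    Set (Fin m → ℝ) :=
  {lam | G.J M T lam < ⊤}

end LTVSystem

end

/-! ### Bounds between quadratic forms and matrix entries. -/

section QuadraticForm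

variable {n : Type*} [Fintype n]

/-! Since `R` is negative definite, a Schur complement eliminates the input: the matrix inequality
says exactly that `P` is a strict supersolution, `P' + Ric(P) ≺ 0`, of the equation `Y' + Ric(Y) =
0`, where `Ric(Y) = Fᵀ Y + Y F + H + Y N Y` and `N = -B R⁻¹ Bᵀ ⪰ 0` (`negDef_DLMI_iff`,
`RDE_eq_zero_iff`).

Comparison: `D = P - Y` satisfies a Lyapunov inequality with matrix `F + N Y`, because the quadratic
remainder `D N D` has the right sign. As `D(T) ⪰ 0`, it follows backwards in time that `D ⪰ 0`
(`posSemidef_of_lyapunov`, `riccati_posSemidef_sub`). Hence every feasible value at time 0 is at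
least that of `Y`.

Existence of `Y`: a feasible `P` bounds solutions from above, and a Lyapunov comparison bounds them
from below by an exponential multiple of the identity. This excludes blow-up
(`exists_riccati_bound`). Clamping makes the right-hand side globally Lipschitz, so Picard–Lindelöf
applies, and the bound shows that the clamp is never active (`exists_riccati_solution`).

Conversely, `Y + ε exp(k(T - t)) I` is feasible for suitable `k` and all small `ε > 0`
(`exists_riccati_strict_supersolution`); letting `ε → 0` shows that the infimum is the value of `Y`.
-/

theorem dotProduct_mulVec_eq_sum (X : Matrix n n ℝ) (x : n → ℝ) :
    x ⬝ᵥ (X *ᵥ x) = ∑ i, ∑ j, x i * (X i j * x j) := by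
  simp [dotProduct, mulVec, Finset.mul_sum]

theorem abs_dotProduct_mulVec_le {X : Matrix n n ℝ} {c : ℝ} (h : ∀ i j, |X i j| ≤ c)
    (x : n → ℝ) : |x ⬝ᵥ (X *ᵥ x)| ≤ Fintype.card n * c * (x ⬝ᵥ x) := by
  rcases isEmpty_or_nonempty n with hn | ⟨⟨i₀⟩⟩
  · simp
  have hc : 0 ≤ c := (abs_nonneg _).trans (h i₀ i₀)
  rw [dotProduct_mulVec_eq_sum]
  calc |∑ i, ∑ j, x i * (X i j * x j)| ≤ ∑ i, ∑ j, c * ((x i ^ 2 + x j ^ 2) / 2) := by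
        refine (Finset.abs_sum_le_sum_abs _ _).trans (Finset.sum_le_sum fun i _ => ?_)
        refine (Finset.abs_sum_le_sum_abs _ _).trans (Finset.sum_le_sum fun j _ => ?_)
        have h1 : |x i * (X i j * x j)| = |X i j| * (|x i| * |x j|) := by
          rw [abs_mul, abs_mul]; ring
        have h2 : |x i| * |x j| ≤ (x i ^ 2 + x j ^ 2) / 2 := by
          nlinarith [sq_nonneg (|x i| - |x j|), sq_abs (x i), sq_abs (x j)]
        rw [h1]
        exact mul_le_mul (h i j) h2 (by positivity) hc
    _ = Fintype.card n * c * (x ⬝ᵥ x) := by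
        simp only [dotProduct, ← Finset.mul_sum, ← Finset.sum_div, Finset.sum_add_distrib,
          Finset.sum_const, Finset.card_univ, nsmul_eq_mul, ← pow_two]
        ring

theorem dotProduct_self_pos_of_ne_zero {x : n → ℝ} (hx : x ≠ 0) : 0 < x ⬝ᵥ x := by
  simpa using dotProduct_star_self_pos_iff.2 hx

/-- A two-sided bound on the quadratic form of a symmetric matrix bounds its entries. -/
theorem abs_apply_le_of_abs_dotProduct_mulVec_le [DecidableEq n] {X : Matrix n n ℝ}
    (hX : X.IsSymm) {c : ℝ} (h : ∀ x, |x ⬝ᵥ (X *ᵥ x)| ≤ c * (x ⬝ᵥ x)) (i j : n) :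
    |X i j| ≤ c := by
  have hij : X j i = X i j := hX.apply i j
  -- Polarization: the forms at the sum and the difference of two basis vectors differ by four times
  -- the entry, and by the parallelogram law the two squared lengths add up to 4.
  have h1 := abs_le.1 (h (Pi.single i 1 + Pi.single j 1))
  have h2 := abs_le.1 (h (Pi.single i 1 - Pi.single j 1))
  have hd : (Pi.single j 1 : n → ℝ) i = (Pi.single i 1 : n → ℝ) j := by
    simp [Pi.single_apply, eq_comm]
  simp [mulVec_add, mulVec_sub, add_dotProduct, sub_dotProduct, hij, hd] at h1 h2
  rw [abs_le]
  constructor <;> linarith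

theorem posSemidef_iff_of_isSymm {X : Matrix n n ℝ} (hX : X.IsSymm) :
    X.PosSemidef ↔ ∀ x, 0 ≤ x ⬝ᵥ (X *ᵥ x) := by
  rw [posSemidef_iff_dotProduct_mulVec]
  exact ⟨fun h => by simpa using h.2, fun h => ⟨hX, by simpa using h⟩⟩

theorem exists_abs_dotProduct_mulVec_le {X : ℝ → Matrix n n ℝ} {s : Set ℝ} (hs : IsCompact s)
    (hX : ContinuousOn X s) :
    ∃ c, 0 ≤ c ∧ ∀ t ∈ s, ∀ x, |x ⬝ᵥ (X t *ᵥ x)| ≤ c * (x ⬝ᵥ x) := by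
  have hb : ∀ p : n × n, ∃ c, ∀ t ∈ s, |X t p.1 p.2| ≤ c := fun p =>
    hs.exists_bound_of_continuousOn (f := fun t => X t p.1 p.2)
      (continuousOn_pi.1 (continuousOn_pi.1 hX p.1) p.2)
  choose c hc using hb
  refine ⟨Fintype.card n * ∑ p, |c p|, by positivity, fun t ht x =>
    abs_dotProduct_mulVec_le (fun i j => (hc (i, j) t ht).trans ?_) x⟩
  exact (le_abs_self _).trans
    (Finset.single_le_sum (f := fun p => |c p|) (fun _ _ => abs_nonneg _) (Finset.mem_univ (i, j)))

end QuadraticForm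

theorem hasDerivWithinAt_exp_mul_sub (c k T t : ℝ) (s : Set ℝ) :
    HasDerivWithinAt (fun s => c * Real.exp (k * (T - s)))
      (-(k * (c * Real.exp (k * (T - t))))) s t := by
  have h1 : HasDerivAt (fun s => k * (T - s)) (k * (-1)) t :=
    ((hasDerivAt_id t).const_sub T).const_mul k
  exact (h1.exp.const_mul c).hasDerivWithinAt.congr_deriv (by ring)

/-- Adding an exponentially weighted multiple of the identity to a matrix function. -/
theorem hasDerivWithinAt_add_exp_smul_one {n : Type*} [DecidableEq n] {D D' : ℝ → Matrix n n ℝ} {s : Set ℝ}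
    {t : ℝ} (c k T : ℝ) (i j : n)
    (h : HasDerivWithinAt (fun s => D s i j) (D' t i j) s t) :
    HasDerivWithinAt
      (fun s => (D s + (c * Real.exp (k * (T - s))) • (1 : Matrix n n ℝ)) i j)
      ((D' t - (k * (c * Real.exp (k * (T - t)))) • (1 : Matrix n n ℝ)) i j) s t := by
  exact (h.add ((hasDerivWithinAt_exp_mul_sub c k T t s).mul_const
    ((1 : Matrix n n ℝ) i j))).congr_deriv (by simp [sub_eq_add_neg])

/-! ### Backward comparison for Lyapunov inequalities. -/

section Comparison

variable {n : Type*} [Fintype n]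

/-- A differentiable symmetric matrix function that is positive definite at the final time stays so
backwards in time if its quadratic form decreases strictly along its kernel. -/
theorem dotProduct_mulVec_pos_of_kernel_deriv_neg {D D' : ℝ → Matrix n n ℝ} {a T : ℝ}
    (hsymm : ∀ t ∈ Icc a T, (D t).IsSymm)
    (hderiv : ∀ t ∈ Icc a T, ∀ i j,
      HasDerivWithinAt (fun s => D s i j) (D' t i j) (Icc a T) t)
    (hT : ∀ x, x ≠ 0 → 0 < x ⬝ᵥ (D T *ᵥ x))
    (h : ∀ t ∈ Ico a T, ∀ x, x ≠ 0 → D t *ᵥ x = 0 → x ⬝ᵥ (D' t *ᵥ x) < 0) :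
    ∀ t ∈ Icc a T, ∀ x, x ≠ 0 → 0 < x ⬝ᵥ (D t *ᵥ x) := by
  by_contra! hcon
  obtain ⟨t₀, ht₀, x₀, hx₀, hneg⟩ := hcon
  have hscale : ∀ t (x : n → ℝ), (‖x‖⁻¹ • x) ⬝ᵥ (D t *ᵥ (‖x‖⁻¹ • x)) =
      (‖x‖⁻¹ * ‖x‖⁻¹) * (x ⬝ᵥ (D t *ᵥ x)) := fun t x => by
    simp [mulVec_smul, mul_assoc]
  have hunit : ∀ x : n → ℝ, x ≠ 0 → ‖x‖⁻¹ • x ∈ Metric.sphere (0 : n → ℝ) 1 := fun x hx => by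
    simp [norm_smul, hx]
  have hcont : ContinuousOn (fun p : ℝ × (n → ℝ) => p.2 ⬝ᵥ (D p.1 *ᵥ p.2))
      (Icc a T ×ˢ Metric.sphere 0 1) := by
    simp only [dotProduct_mulVec_eq_sum]
    refine continuousOn_finsetSum _ fun i _ => continuousOn_finsetSum _ fun j _ => ?_
    have h1 : ContinuousOn (fun p : ℝ × (n → ℝ) => D p.1 i j) (Icc a T ×ˢ Metric.sphere 0 1) :=
      ContinuousOn.comp (g := fun t => D t i j) (fun t ht => (hderiv t ht i j).continuousWithinAt)
        continuousOn_fst fun p hp => hp.1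
    exact ContinuousOn.mul (by fun_prop) (h1.mul (by fun_prop))
  have hK : IsCompact (Icc a T ×ˢ Metric.sphere (0 : n → ℝ) 1) :=
    isCompact_Icc.prod (isCompact_sphere _ _)
  have hbad : IsCompact (Prod.fst '' ((Icc a T ×ˢ Metric.sphere (0 : n → ℝ) 1) ∩
      (fun p : ℝ × (n → ℝ) => p.2 ⬝ᵥ (D p.1 *ᵥ p.2)) ⁻¹' Iic 0)) :=
    (hK.of_isClosed_subset (hcont.preimage_isClosed_of_isClosed hK.isClosed isClosed_Iic)
      inter_subset_left).image continuous_fst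
  -- By compactness of the unit sphere there is a last time `t₁` at which positivity fails, with a
  -- witness `x`.
  obtain ⟨_, ⟨⟨t₁, x⟩, ⟨⟨ht₁, hx1⟩, hx⟩, rfl⟩, hmax⟩ := hbad.exists_isGreatest
    ⟨t₀, (t₀, ‖x₀‖⁻¹ • x₀), ⟨⟨ht₀, hunit x₀ hx₀⟩, by
      simp only [mem_preimage, mem_Iic, hscale]
      exact mul_nonpos_of_nonneg_of_nonpos (by positivity) hneg⟩, rfl⟩
  dsimp only at ht₁ hx1 hx hmax
  have hx0 : x ≠ 0 := by rintro rfl; simp at hx1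
  have hlater : ∀ t ∈ Ioc t₁ T, ∀ y, y ≠ 0 → 0 < y ⬝ᵥ (D t *ᵥ y) := by
    intro t ht y hy
    by_contra! hle
    refine not_le_of_gt ht.1 (hmax ⟨(t, ‖y‖⁻¹ • y), ⟨⟨⟨ht₁.1.trans ht.1.le, ht.2⟩, hunit y hy⟩, ?_⟩, rfl⟩)
    simp only [mem_preimage, mem_Iic, hscale]
    exact mul_nonpos_of_nonneg_of_nonpos (by positivity) hle
  have hlt : t₁ < T := by
    refine lt_of_le_of_ne ht₁.2 fun he => ?_
    rw [he] at hx
    exact absurd (hT x hx0) (not_lt.2 hx)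
  have hqd : ∀ y : n → ℝ, HasDerivWithinAt (fun s => y ⬝ᵥ (D s *ᵥ y)) (y ⬝ᵥ (D' t₁ *ᵥ y))
      (Ioi t₁) t₁ := by
    intro y
    simp only [dotProduct_mulVec_eq_sum]
    refine HasDerivWithinAt.fun_sum fun i _ => HasDerivWithinAt.fun_sum fun j _ => ?_
    have h1 : HasDerivWithinAt (fun s => D s i j) (D' t₁ i j) (Ioi t₁) t₁ :=
      ((hderiv t₁ ht₁ i j).mono (Icc_subset_Icc_left ht₁.1)).mono_of_mem_nhdsWithin
        (Icc_mem_nhdsGT hlt)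
    exact (h1.mul_const _).const_mul _
  have hev : ∀ᶠ t in nhdsWithin t₁ (Ioi t₁), t ∈ Ioc t₁ T := Ioc_mem_nhdsGT hlt
  -- As a limit from the right, `D t₁` is still semidefinite, so a null vector of its form lies in
  -- its kernel. The form at `x` then rises from zero to the right of `t₁`, against the assumed
  -- negative derivative.
  have hpsd : (D t₁).PosSemidef := by
    refine (posSemidef_iff_of_isSymm (hsymm t₁ ht₁)).2 fun y => ?_
    rcases eq_or_ne y 0 with rfl | hy
    · simp
    · exact ge_of_tendsto (hqd y).continuousWithinAt
        (hev.mono fun t ht => (hlater t ht y hy).le)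
  have hzero : x ⬝ᵥ (D t₁ *ᵥ x) = 0 :=
    le_antisymm hx ((posSemidef_iff_of_isSymm (hsymm t₁ ht₁)).1 hpsd x)
  have hker : D t₁ *ᵥ x = 0 := (hpsd.dotProduct_mulVec_zero_iff x).1 (by simpa using hzero)
  refine absurd (h t₁ ⟨ht₁.1, hlt⟩ x hx0 hker) (not_lt.2 ?_)
  have hs := (hasDerivWithinAt_iff_tendsto_slope' (by simp)).1 (hqd x)
  refine ge_of_tendsto hs (hev.mono fun t ht => ?_)
  rw [slope_def_field, hzero, sub_zero]
  exact div_nonneg (hlater t ht x hx0).le (sub_nonneg.2 ht.1.le)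

/-- Comparison principle for the Lyapunov differential inequality. -/
theorem posSemidef_of_lyapunov {D D' F : ℝ → Matrix n n ℝ} {a T k : ℝ}
    (hsymm : ∀ t ∈ Icc a T, (D t).IsSymm)
    (hderiv : ∀ t ∈ Icc a T, ∀ i j,
      HasDerivWithinAt (fun s => D s i j) (D' t i j) (Icc a T) t)
    (hF : ∀ t ∈ Icc a T, ∀ x, x ⬝ᵥ (((F t)ᵀ + F t) *ᵥ x) ≤ k * (x ⬝ᵥ x))
    (hT : (D T).PosSemidef)
    (h : ∀ t ∈ Icc a T, ∀ x,
      x ⬝ᵥ ((D' t + ((F t)ᵀ * D t + D t * F t)) *ᵥ x) ≤ 0) :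
    ∀ t ∈ Icc a T, (D t).PosSemidef := by
  classical
  intro t ht
  rw [posSemidef_iff_of_isSymm (hsymm t ht)]
  intro x
  have key : ∀ ε > 0, 0 ≤ x ⬝ᵥ (D t *ᵥ x) +
      ε * (Real.exp ((k + 1) * (T - t)) * (x ⬝ᵥ x)) := by
    intro ε hε
    rcases eq_or_ne x 0 with rfl | hx
    · simp
    -- On the kernel of the perturbed matrix, `D` acts as `-φ`, so the Lyapunov term costs at most
    -- `k φ |y|²`; the rate `k + 1` pays for it with `φ |y|²` to spare, which gives strictness.
    have := dotProduct_mulVec_pos_of_kernel_deriv_neg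
      (D := fun s => D s + (ε * Real.exp ((k + 1) * (T - s))) • (1 : Matrix n n ℝ))
      (D' := fun s => D' s - ((k + 1) * (ε * Real.exp ((k + 1) * (T - s)))) • (1 : Matrix n n ℝ))
      (a := a) (T := T) (fun s hs => (hsymm s hs).add ((isSymm_one).smul _))
      (fun s hs i j => hasDerivWithinAt_add_exp_smul_one ε (k + 1) T i j (hderiv s hs i j))
      (fun y hy => by
        have h1 := hT.dotProduct_mulVec_nonneg y
        have h2 := dotProduct_self_pos_of_ne_zero hy
        simp only [star_trivial] at h1
        simp only [sub_self, mul_zero, Real.exp_zero, mul_one, add_mulVec, smul_mulVec,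
          one_mulVec, dotProduct_add, dotProduct_smul, smul_eq_mul]
        positivity)
      (fun s hs y hy hker => by
        have hs' : s ∈ Icc a T := ⟨hs.1, hs.2.le⟩
        have h1 := h s hs' y
        have h2 := hF s hs' y
        have h3 := dotProduct_self_pos_of_ne_zero hy
        have hφ : 0 < ε * Real.exp ((k + 1) * (T - s)) := by positivity
        generalize ε * Real.exp ((k + 1) * (T - s)) = φ at hker hφ ⊢
        have hDy : D s *ᵥ y = -(φ • y) := by
          simp only [add_mulVec, smul_mulVec, one_mulVec] at hker
          exact eq_neg_of_add_eq_zero_left hker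
        have e1 : y ⬝ᵥ (((F s)ᵀ * D s) *ᵥ y) = -(φ * (y ⬝ᵥ ((F s)ᵀ *ᵥ y))) := by
          rw [← mulVec_mulVec, hDy, mulVec_neg, mulVec_smul, dotProduct_neg, dotProduct_smul,
            smul_eq_mul]
        have e2 : y ⬝ᵥ ((D s * F s) *ᵥ y) = -(φ * (y ⬝ᵥ (F s *ᵥ y))) := by
          rw [← mulVec_mulVec, dotProduct_mulVec, ← mulVec_transpose, (hsymm s hs').eq, hDy,
            neg_dotProduct, smul_dotProduct, smul_eq_mul]
        simp only [add_mulVec, dotProduct_add, e1, e2] at h1 h2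
        simp only [sub_mulVec, smul_mulVec, one_mulVec, dotProduct_sub, dotProduct_smul,
          smul_eq_mul]
        nlinarith [mul_le_mul_of_nonneg_left h2 hφ.le, mul_pos hφ h3])
      t ht x hx
    simp only [add_mulVec, smul_mulVec, one_mulVec, dotProduct_add, dotProduct_smul,
      smul_eq_mul] at this
    linarith
  refine ge_of_tendsto (f := fun ε => x ⬝ᵥ (D t *ᵥ x) +
      ε * (Real.exp ((k + 1) * (T - t)) * (x ⬝ᵥ x))) (x := nhdsWithin 0 (Ioi 0)) ?_
    (eventually_mem_nhdsWithin.mono key)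
  refine Filter.Tendsto.mono_left ?_ nhdsWithin_le_nhds
  have : Continuous fun ε : ℝ => x ⬝ᵥ (D t *ᵥ x) +
      ε * (Real.exp ((k + 1) * (T - t)) * (x ⬝ᵥ x)) := by fun_prop
  simpa using this.tendsto 0

end Comparison

/-! ### Riccati comparison and a priori bounds. -/

section Riccati

variable {n : Type*} [Fintype n]

/-- The right-hand side `Fᵀ Y + Y F + H + Y N Y` of a Riccati equation. -/
noncomputable def riccatiMap (F H N Y : Matrix n n ℝ) : Matrix n n ℝ :=
  Fᵀ * Y + Y * F + H + Y * N * Y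

theorem riccatiMap_isSymm {F H N Y : Matrix n n ℝ} (hH : H.IsSymm) (hN : N.IsSymm)
    (hY : Y.IsSymm) : (riccatiMap F H N Y).IsSymm := by
  simp only [riccatiMap, IsSymm, transpose_add, transpose_mul, transpose_transpose, hH.eq, hN.eq,
    hY.eq, Matrix.mul_assoc]
  abel

/-- Exact Taylor expansion at `Y`: the linear part is a Lyapunov operator, and the remainder is
semidefinite once `N` is, so supersolutions can be compared without any smallness assumption. -/
theorem riccatiMap_sub {F H N P Y : Matrix n n ℝ} (hN : N.IsSymm) (hY : Y.IsSymm) :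
    riccatiMap F H N P - riccatiMap F H N Y =
      ((F + N * Y)ᵀ * (P - Y) + (P - Y) * (F + N * Y)) + (P - Y) * N * (P - Y) := by
  simp only [riccatiMap, transpose_add, transpose_mul, hN.eq, hY.eq]
  noncomm_ring

theorem posSemidef_mul_mul_of_isSymm {N D : Matrix n n ℝ} (hN : N.PosSemidef) (hD : D.IsSymm)
    (x : n → ℝ) : 0 ≤ x ⬝ᵥ ((D * N * D) *ᵥ x) := by
  have h := (hN.conjTranspose_mul_mul_same D).dotProduct_mulVec_nonneg x
  simpa [conjTranspose_eq_transpose_of_trivial, hD.eq] using h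

/-- A supersolution of a Riccati equation dominates a solution. -/
theorem riccati_posSemidef_sub {F H N P P' Y : ℝ → Matrix n n ℝ} {a T : ℝ}
    (hF : ContinuousOn F (Icc a T)) (hNc : ContinuousOn N (Icc a T))
    (hN : ∀ t ∈ Icc a T, (N t).PosSemidef)
    (hPs : ∀ t ∈ Icc a T, (P t).IsSymm) (hYs : ∀ t ∈ Icc a T, (Y t).IsSymm)
    (hP : ∀ t ∈ Icc a T, ∀ i j,
      HasDerivWithinAt (fun s => P s i j) (P' t i j) (Icc a T) t)
    (hY : ∀ t ∈ Icc a T, ∀ i j, HasDerivWithinAt (fun s => Y s i j)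
      ((-riccatiMap (F t) (H t) (N t) (Y t)) i j) (Icc a T) t)
    (hsup : ∀ t ∈ Icc a T, ∀ x,
      x ⬝ᵥ ((P' t + riccatiMap (F t) (H t) (N t) (P t)) *ᵥ x) ≤ 0)
    (hT : (P T - Y T).PosSemidef) :
    ∀ t ∈ Icc a T, (P t - Y t).PosSemidef := by
  have hYc : ContinuousOn Y (Icc a T) :=
    continuousOn_pi.2 fun i => continuousOn_pi.2 fun j t ht => (hY t ht i j).continuousWithinAt
  have hA : ContinuousOn (fun t => F t + N t * Y t) (Icc a T) := hF.add (hNc.mul hYc)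
  obtain ⟨k, -, hk⟩ := exists_abs_dotProduct_mulVec_le isCompact_Icc
    (X := fun t => (F t + N t * Y t)ᵀ + (F t + N t * Y t))
    ((continuous_id.matrix_transpose.comp_continuousOn hA).add hA)
  refine posSemidef_of_lyapunov (D' := fun t => P' t + riccatiMap (F t) (H t) (N t) (Y t))
    (F := fun t => F t + N t * Y t) (k := k)
    (fun t ht => (hPs t ht).sub (hYs t ht)) (fun t ht i j => ?_)
    (fun t ht x => (le_abs_self _).trans (hk t ht x)) hT fun t ht x => ?_
  · exact ((hP t ht i j).sub (hY t ht i j)).congr_deriv (by simp)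
  · have h1 := hsup t ht x
    have h2 := posSemidef_mul_mul_of_isSymm (hN t ht) ((hPs t ht).sub (hYs t ht)) x
    have h3 := riccatiMap_sub (F := F t) (H := H t) (P := P t)
      (isHermitian_iff_isSymm.1 (hN t ht).isHermitian) (hYs t ht)
    rw [sub_eq_iff_eq_add] at h3
    simp only [h3, add_mulVec, dotProduct_add] at h1 ⊢
    linarith

/-- A priori bound for solutions of a Riccati equation that admits a supersolution. -/
theorem exists_riccati_bound {F H N P P' : ℝ → Matrix n n ℝ} {T : ℝ}
    (hF : ContinuousOn F (Icc 0 T)) (hH : ContinuousOn H (Icc 0 T))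
    (hNc : ContinuousOn N (Icc 0 T)) (hN : ∀ t ∈ Icc 0 T, (N t).PosSemidef)
    (hPs : ∀ t ∈ Icc 0 T, (P t).IsSymm)
    (hP : ∀ t ∈ Icc 0 T, ∀ i j,
      HasDerivWithinAt (fun s => P s i j) (P' t i j) (Icc 0 T) t)
    (hsup : ∀ t ∈ Icc 0 T, ∀ x,
      x ⬝ᵥ ((P' t + riccatiMap (F t) (H t) (N t) (P t)) *ᵥ x) ≤ 0)
    (hT : (P T).PosSemidef) :
    ∃ C, 0 ≤ C ∧ ∀ a ∈ Icc 0 T, ∀ Y : ℝ → Matrix n n ℝ, (∀ t ∈ Icc a T, (Y t).IsSymm) →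
      (∀ t ∈ Icc a T, ∀ i j, HasDerivWithinAt (fun s => Y s i j)
        ((-riccatiMap (F t) (H t) (N t) (Y t)) i j) (Icc a T) t) →
      Y T = 0 → ∀ t ∈ Icc a T, ∀ i j, |Y t i j| ≤ C := by
  classical
  have hPc : ContinuousOn P (Icc 0 T) :=
    continuousOn_pi.2 fun i => continuousOn_pi.2 fun j t ht => (hP t ht i j).continuousWithinAt
  obtain ⟨p, hp0, hp⟩ := exists_abs_dotProduct_mulVec_le isCompact_Icc hPc
  obtain ⟨h, hh0, hh⟩ := exists_abs_dotProduct_mulVec_le isCompact_Icc hH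
  obtain ⟨f, hf0, hf⟩ := exists_abs_dotProduct_mulVec_le isCompact_Icc
    (X := fun t => (F t)ᵀ + F t) ((continuous_id.matrix_transpose.comp_continuousOn hF).add hF)
  refine ⟨p + h * Real.exp ((f + 1) * T), by positivity, fun a ha Y hYs hY hYT t ht i j => ?_⟩
  have hsub : Icc a T ⊆ Icc 0 T := Icc_subset_Icc_left ha.1
  have hupper : (P t - Y t).PosSemidef :=
    riccati_posSemidef_sub (hF.mono hsub) (hNc.mono hsub) (fun t ht => hN t (hsub ht))
      (fun t ht => hPs t (hsub ht)) hYs (fun t ht i j => (hP t (hsub ht) i j).mono hsub) hY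
      (fun t ht => hsup t (hsub ht)) (by simpa [hYT] using hT) t ht
  -- With `φ` the added multiple, the Lyapunov expression is `-H - Y N Y + φ (Fᵀ + F) - (f + 1) φ
  -- I`. Its form is at most `(h - φ) |x|²`, and `φ ≥ h` because the exponential is at least 1.
  have hlower : (Y t + (h * Real.exp ((f + 1) * (T - t))) • (1 : Matrix n n ℝ)).PosSemidef := by
    refine posSemidef_of_lyapunov
      (D := fun s => Y s + (h * Real.exp ((f + 1) * (T - s))) • (1 : Matrix n n ℝ))
      (D' := fun s => -riccatiMap (F s) (H s) (N s) (Y s) -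
        ((f + 1) * (h * Real.exp ((f + 1) * (T - s)))) • (1 : Matrix n n ℝ)) (F := F) (k := f)
      (fun t ht => (hYs t ht).add (isSymm_one.smul _))
      (fun t ht i j => hasDerivWithinAt_add_exp_smul_one
        (D' := fun s => -riccatiMap (F s) (H s) (N s) (Y s)) h (f + 1) T i j (hY t ht i j))
      (fun t ht x => (le_abs_self _).trans (hf t (hsub ht) x)) ?_ (fun t ht x => ?_) t ht
    · simpa [hYT] using PosSemidef.one.smul hh0
    · have h1 := posSemidef_mul_mul_of_isSymm (hN t (hsub ht)) (hYs t ht) x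
      have h2 := (abs_le.1 (hh t (hsub ht) x)).1
      have h3 := (abs_le.1 (hf t (hsub ht) x)).2
      have hxx : 0 ≤ x ⬝ᵥ x := dotProduct_self_star_nonneg x
      have he : h ≤ h * Real.exp ((f + 1) * (T - t)) :=
        le_mul_of_one_le_right hh0 (Real.one_le_exp
          (mul_nonneg (by positivity) (sub_nonneg.2 ht.2)))
      generalize h * Real.exp ((f + 1) * (T - t)) = φ at he ⊢
      simp only [riccatiMap, add_mulVec, sub_mulVec, neg_mulVec, smul_mulVec, one_mulVec,
        dotProduct_add, dotProduct_sub, dotProduct_neg, dotProduct_smul, smul_eq_mul,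
        Matrix.mul_add, Matrix.add_mul, Matrix.mul_smul, Matrix.smul_mul, Matrix.mul_one,
        Matrix.one_mul] at h3 ⊢
      nlinarith [mul_le_mul_of_nonneg_left h3 (hh0.trans he), mul_le_mul_of_nonneg_right he hxx]
  refine abs_apply_le_of_abs_dotProduct_mulVec_le (hYs t ht) (fun x => ?_) i j
  have h1 := hupper.dotProduct_mulVec_nonneg x
  have h2 := hlower.dotProduct_mulVec_nonneg x
  have h3 := (abs_le.1 (hp t (hsub ht) x)).2
  have hxx : 0 ≤ x ⬝ᵥ x := dotProduct_self_star_nonneg x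
  have he : h * Real.exp ((f + 1) * (T - t)) ≤ h * Real.exp ((f + 1) * T) := by
    gcongr
    linarith [ha.1, ht.1]
  have he0 : 0 ≤ h * Real.exp ((f + 1) * T) := by positivity
  simp only [star_trivial, sub_mulVec, add_mulVec, smul_mulVec, one_mulVec, dotProduct_sub,
    dotProduct_add, dotProduct_smul, smul_eq_mul] at h1 h2
  rw [abs_le]
  constructor <;> nlinarith [mul_le_mul_of_nonneg_right he hxx, mul_nonneg hp0 hxx,
    mul_nonneg he0 hxx]

end Riccati

/-! ### Global existence by clamping and continuation. -/

section RiccatiExistence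

attribute [local instance] Matrix.normedAddCommGroup Matrix.normedSpace

variable {n : Type*} [Fintype n]

theorem norm_matrix_mul_le_card_mul (X Y : Matrix n n ℝ) :
    ‖X * Y‖ ≤ Fintype.card n * (‖X‖ * ‖Y‖) := by
  refine (norm_le_iff (by positivity)).2 fun i j => ?_
  rw [mul_apply]
  refine (norm_sum_le _ _).trans ((Finset.sum_le_sum fun k _ => ?_).trans
    (b := ∑ _k : n, ‖X‖ * ‖Y‖) (by simp))
  rw [norm_mul]
  exact mul_le_mul (norm_entry_le_entrywise_sup_norm X) (norm_entry_le_entrywise_sup_norm Y)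
    (norm_nonneg _) (norm_nonneg _)

theorem norm_riccatiMap_sub_le {F H N U V : Matrix n n ℝ} {c K : ℝ} (hF : ‖F‖ ≤ c)
    (hN : ‖N‖ ≤ c) (hU : ‖U‖ ≤ K) (hV : ‖V‖ ≤ K) :
    ‖riccatiMap F H N U - riccatiMap F H N V‖ ≤
      2 * (Fintype.card n * c + Fintype.card n ^ 2 * c * K) * ‖U - V‖ := by
  set d : ℝ := (Fintype.card n : ℝ)
  have hd : 0 ≤ d := by positivity
  have hc : 0 ≤ c := (norm_nonneg _).trans hF
  have hK : 0 ≤ K := (norm_nonneg _).trans hU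
  have hmul : ∀ (X Y : Matrix n n ℝ) {x y : ℝ}, ‖X‖ ≤ x → ‖Y‖ ≤ y → ‖X * Y‖ ≤ d * (x * y) :=
    fun X Y x y hx hy => (norm_matrix_mul_le_card_mul X Y).trans
      (mul_le_mul_of_nonneg_left (mul_le_mul hx hy (norm_nonneg _) ((norm_nonneg _).trans hx)) hd)
  -- The quadratic difference is telescoped. The entrywise sup norm is not submultiplicative, hence
  -- the powers of the dimension in the constant.
  have e : riccatiMap F H N U - riccatiMap F H N V =
      Fᵀ * (U - V) + (U - V) * F + (U - V) * (N * U) + V * N * (U - V) := by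
    simp only [riccatiMap]
    noncomm_ring
  have h1 := hmul Fᵀ (U - V) ((norm_transpose F).le.trans hF) le_rfl
  have h2 := hmul (U - V) F le_rfl hF
  have h3 := hmul (U - V) (N * U) le_rfl (hmul N U hN hU)
  have h4 := hmul (V * N) (U - V) (hmul V N hV hN) le_rfl
  rw [e]
  refine (norm_add₄_le ..).trans ?_
  linarith

/-- The symmetric part of a matrix with entries clamped to `[-K, K]`. -/
noncomputable def clampSymm (K : ℝ) (Y : Matrix n n ℝ) : Matrix n n ℝ :=
  of fun i j => max (-K) (min K ((Y i j + Y j i) / 2))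

omit [Fintype n] in
-- Symmetrizing inside the clamp makes the clamped right-hand side symmetric before anything is
-- known about the solution, whose symmetry then follows.
theorem clampSymm_isSymm (K : ℝ) (Y : Matrix n n ℝ) : (clampSymm K Y).IsSymm := by
  ext i j
  simp [clampSymm, add_comm]

theorem norm_clampSymm_le {K : ℝ} (hK : 0 ≤ K) (Y : Matrix n n ℝ) : ‖clampSymm K Y‖ ≤ K := by
  refine (norm_le_iff hK).2 fun i j => abs_le.2 ⟨le_max_left _ _, ?_⟩
  exact max_le (by linarith) (min_le_left _ _)

theorem norm_clampSymm_sub_le (K : ℝ) (Y Z : Matrix n n ℝ) :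
    ‖clampSymm K Y - clampSymm K Z‖ ≤ ‖Y - Z‖ := by
  refine (norm_le_iff (norm_nonneg _)).2 fun i j => ?_
  have h1 : |Y i j - Z i j| ≤ ‖Y - Z‖ := norm_entry_le_entrywise_sup_norm (Y - Z)
  have h2 : |Y j i - Z j i| ≤ ‖Y - Z‖ := norm_entry_le_entrywise_sup_norm (Y - Z)
  have h3 := abs_max_sub_max_le_max (-K) (min K ((Y i j + Y j i) / 2)) (-K)
    (min K ((Z i j + Z j i) / 2))
  have h4 := abs_min_sub_min_le_max K ((Y i j + Y j i) / 2) K ((Z i j + Z j i) / 2)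
  simp only [sub_self, abs_zero, abs_nonneg, max_eq_right] at h3 h4
  refine h3.trans (h4.trans ?_)
  rw [abs_le] at h1 h2 ⊢
  constructor <;> linarith [h1.1, h1.2, h2.1, h2.2]

omit [Fintype n] in
theorem clampSymm_eq_self {K : ℝ} {Y : Matrix n n ℝ} (hY : Y.IsSymm) (h : ∀ i j, |Y i j| ≤ K) :
    clampSymm K Y = Y := by
  ext i j
  have h1 := abs_le.1 (h i j)
  have h2 := hY.apply i j
  have h3 : (Y i j + Y j i) / 2 = Y i j := by rw [h2]; ring
  simp only [clampSymm, of_apply, h3]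
  rw [min_eq_right h1.2, max_eq_right h1.1]

/-- Existence for the Riccati equation with clamped right-hand side. -/
theorem exists_clamped_riccati_solution {F H N : ℝ → Matrix n n ℝ} {T K : ℝ} (hT : 0 ≤ T)
    (hK : 0 ≤ K) (hF : ContinuousOn F (Icc 0 T)) (hH : ContinuousOn H (Icc 0 T))
    (hN : ContinuousOn N (Icc 0 T)) :
    ∃ Y : ℝ → Matrix n n ℝ, Y T = 0 ∧ ∀ t ∈ Icc 0 T, ∀ i j,
      HasDerivWithinAt (fun s => Y s i j)
        ((-riccatiMap (F t) (H t) (N t) (clampSymm K (Y t))) i j) (Icc 0 T) t := by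
  obtain ⟨cF, hcF⟩ := isCompact_Icc.exists_bound_of_continuousOn hF
  obtain ⟨cH, hcH⟩ := isCompact_Icc.exists_bound_of_continuousOn hH
  obtain ⟨cN, hcN⟩ := isCompact_Icc.exists_bound_of_continuousOn hN
  set c := max cF (max cH cN)
  have h0 : (0 : ℝ) ∈ Icc 0 T := ⟨le_rfl, hT⟩
  have hc : 0 ≤ c := (norm_nonneg _).trans ((hcF 0 h0).trans (le_max_left _ _))
  have hbF : ∀ t ∈ Icc 0 T, ‖F t‖ ≤ c := fun t ht => (hcF t ht).trans (le_max_left _ _)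
  have hbH : ∀ t ∈ Icc 0 T, ‖H t‖ ≤ c := fun t ht =>
    (hcH t ht).trans ((le_max_left _ _).trans (le_max_right _ _))
  have hbN : ∀ t ∈ Icc 0 T, ‖N t‖ ≤ c := fun t ht =>
    (hcN t ht).trans ((le_max_right _ _).trans (le_max_right _ _))
  let l : NNReal := ⟨2 * (Fintype.card n * c + Fintype.card n ^ 2 * c * K), by positivity⟩
  -- Bound on the clamped right-hand side: its value `-H` at zero plus the Lipschitz variation over
  -- matrices of norm at most `K`.
  let L : NNReal := ⟨c + l * K, by positivity⟩
  let f : ℝ → Matrix n n ℝ → Matrix n n ℝ :=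
    fun t Y => -riccatiMap (F t) (H t) (N t) (clampSymm K Y)
  -- The bound `L` holds on the whole space, so the ball may have radius `L T`, just enough to reach
  -- time 0 from `T`.
  have hf : IsPicardLindelof f (tmin := 0) (tmax := T) ⟨T, hT, le_rfl⟩ 0 (L * ⟨T, hT⟩) 0 L l := by
    refine ⟨fun t ht => LipschitzWith.lipschitzOnWith (LipschitzWith.of_dist_le_mul fun Y Z => ?_),
      fun Y _ => ?_, fun t ht Y _ => ?_, ?_⟩
    · rw [dist_eq_norm, dist_eq_norm, neg_sub_neg, norm_sub_rev]
      exact (norm_riccatiMap_sub_le (hbF t ht) (hbN t ht) (norm_clampSymm_le hK _)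
        (norm_clampSymm_le hK _)).trans
          (mul_le_mul_of_nonneg_left (norm_clampSymm_sub_le K Y Z) l.2)
    · exact ((((continuous_id.matrix_transpose.comp_continuousOn hF).mul continuousOn_const).add
        (continuousOn_const.mul hF)).add hH |>.add
        ((continuousOn_const.mul hN).mul continuousOn_const)).neg
    · have h1 := norm_riccatiMap_sub_le (H := H t) (hbF t ht) (hbN t ht) (norm_clampSymm_le hK Y)
        (norm_zero.trans_le hK : ‖(0 : Matrix n n ℝ)‖ ≤ K)
      have h2 : riccatiMap (F t) (H t) (N t) 0 = H t := by simp [riccatiMap]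
      have h3 : ‖clampSymm K Y - 0‖ ≤ K := by simpa using norm_clampSymm_le hK Y
      rw [h2] at h1
      have h4 := norm_le_norm_add_norm_sub' (riccatiMap (F t) (H t) (N t) (clampSymm K Y)) (H t)
      have h5 := mul_le_mul_of_nonneg_left h3 l.2
      change ‖-riccatiMap (F t) (H t) (N t) (clampSymm K Y)‖ ≤ c + l * K
      rw [norm_neg]
      exact h4.trans (add_le_add (hbH t ht) (h1.trans h5))
    · change (L : ℝ) * max (T - T) (T - 0) ≤ L * T - 0
      simp [hT]
  obtain ⟨Y, hYT, hY⟩ := hf.exists_eq_forall_mem_Icc_hasDerivWithinAt₀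
  exact ⟨Y, hYT, fun t ht i j =>
    hasDerivWithinAt_pi.1 (hasDerivWithinAt_pi.1 (hY t ht) i) j⟩

omit [Fintype n] in
/-- A matrix function with symmetric derivative and symmetric final value is symmetric. -/
theorem isSymm_of_deriv_isSymm {Y Y' : ℝ → Matrix n n ℝ} {T : ℝ} (hYT : (Y T).IsSymm)
    (hY' : ∀ t ∈ Icc 0 T, (Y' t).IsSymm)
    (hY : ∀ t ∈ Icc 0 T, ∀ i j, HasDerivWithinAt (fun s => Y s i j) (Y' t i j) (Icc 0 T) t) :
    ∀ t ∈ Icc 0 T, (Y t).IsSymm := by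
  intro t ht
  ext i j
  have h : ∀ s ∈ Icc 0 T, HasDerivWithinAt (fun s => Y s j i - Y s i j) 0 (Icc 0 T) s :=
    fun s hs => ((hY s hs j i).sub (hY s hs i j)).congr_deriv
      (by rw [(hY' s hs).apply, sub_self])
  have hconst := constant_of_derivWithin_zero (fun s hs => (h s hs).differentiableWithinAt)
    fun s hs => (h s ⟨hs.1, hs.2.le⟩).derivWithin
      (uniqueDiffOn_Icc (hs.1.trans_lt hs.2) s ⟨hs.1, hs.2.le⟩)
  have hT := hconst T (right_mem_Icc.2 (ht.1.trans ht.2))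
  rw [hYT.apply, sub_self, ← hconst t ht] at hT
  exact sub_eq_zero.1 hT.symm

/-- A Riccati equation that admits a supersolution has a solution on the whole interval. -/
theorem exists_riccati_solution {F H N P P' : ℝ → Matrix n n ℝ} {T : ℝ} (hT0 : 0 ≤ T)
    (hF : ContinuousOn F (Icc 0 T)) (hH : ContinuousOn H (Icc 0 T))
    (hNc : ContinuousOn N (Icc 0 T)) (hHs : ∀ t ∈ Icc 0 T, (H t).IsSymm)
    (hN : ∀ t ∈ Icc 0 T, (N t).PosSemidef)
    (hPs : ∀ t ∈ Icc 0 T, (P t).IsSymm)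
    (hP : ∀ t ∈ Icc 0 T, ∀ i j,
      HasDerivWithinAt (fun s => P s i j) (P' t i j) (Icc 0 T) t)
    (hsup : ∀ t ∈ Icc 0 T, ∀ x,
      x ⬝ᵥ ((P' t + riccatiMap (F t) (H t) (N t) (P t)) *ᵥ x) ≤ 0)
    (hT : (P T).PosSemidef) :
    ∃ Y : ℝ → Matrix n n ℝ, (∀ t ∈ Icc 0 T, (Y t).IsSymm) ∧ Y T = 0 ∧
      ∀ t ∈ Icc 0 T, ∀ i j, HasDerivWithinAt (fun s => Y s i j)
        ((-riccatiMap (F t) (H t) (N t) (Y t)) i j) (Icc 0 T) t := by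
  obtain ⟨C, hC0, hC⟩ := exists_riccati_bound hF hH hNc hN hPs hP hsup hT
  -- Clamping one unit above the a priori bound leaves a gap that a continuous solution cannot jump.
  obtain ⟨Y, hYT, hY⟩ := exists_clamped_riccati_solution (K := C + 1) hT0 (by positivity) hF hH hNc
  have hYs : ∀ t ∈ Icc 0 T, (Y t).IsSymm := by
    refine isSymm_of_deriv_isSymm (by simp [hYT]) (fun t ht => ?_) hY
    exact (riccatiMap_isSymm (hHs t ht) (isHermitian_iff_isSymm.1 (hN t ht).isHermitian)
      (clampSymm_isSymm _ _)).neg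
  have hYc : ContinuousOn Y (Icc 0 T) :=
    continuousOn_pi.2 fun i => continuousOn_pi.2 fun j t ht => (hY t ht i j).continuousWithinAt
  have hsmall : ∀ t ∈ Icc 0 T, ‖Y t‖ < C + 1 := by
    by_contra! hcon
    obtain ⟨t₀, ht₀, hlarge⟩ := hcon
    have hbad : IsCompact (Icc 0 T ∩ (fun t => ‖Y t‖) ⁻¹' Ici (C + 1)) :=
      isCompact_Icc.of_isClosed_subset
        (hYc.norm.preimage_isClosed_of_isClosed isClosed_Icc isClosed_Ici) inter_subset_left
    obtain ⟨t₁, ⟨ht₁, hl⟩, hmax⟩ := hbad.exists_isGreatest ⟨t₀, ht₀, hlarge⟩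
    simp only [mem_preimage, mem_Ici] at hl
    have hlt : t₁ < T := by
      refine lt_of_le_of_ne ht₁.2 fun he => ?_
      rw [he, hYT, norm_zero] at hl
      linarith
    -- After the last time `t₁` of norm at least `C + 1` the clamp is inactive, so the true equation
    -- and hence the bound `C` hold on `[a, T]`. This needs `C` independent of `a`.
    have hlater : ∀ a ∈ Ioc t₁ T, ‖Y a‖ ≤ C := by
      intro a ha
      have ha' : a ∈ Icc 0 T := ⟨ht₁.1.trans ha.1.le, ha.2⟩
      have hsub : Icc a T ⊆ Icc 0 T := Icc_subset_Icc_left ha'.1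
      refine (norm_le_iff hC0).2 (hC a ha' Y (fun t ht => hYs t (hsub ht)) (fun t ht i j => ?_)
        hYT a ⟨le_rfl, ha.2⟩)
      have hnb : ‖Y t‖ ≤ C + 1 := by
        by_contra! hgt
        exact not_lt_of_ge (hmax ⟨hsub ht, hgt.le⟩) (ha.1.trans_le ht.1)
      have h1 := (hY t (hsub ht) i j).mono hsub
      rwa [clampSymm_eq_self (hYs t (hsub ht))
        fun i j => (norm_entry_le_entrywise_sup_norm (Y t)).trans hnb] at h1
    have hle : ‖Y t₁‖ ≤ C := by
      have h1 : Filter.Tendsto (fun t => ‖Y t‖) (nhdsWithin t₁ (Ioi t₁)) (nhds ‖Y t₁‖) :=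
        (hYc.norm t₁ ht₁).mono_left (nhdsWithin_le_of_mem
          (Filter.mem_of_superset (Icc_mem_nhdsGT hlt) (Icc_subset_Icc_left ht₁.1)))
      exact le_of_tendsto h1 (Filter.mem_of_superset (Ioc_mem_nhdsGT hlt) hlater)
    linarith
  refine ⟨Y, hYs, hYT, fun t ht i j => ?_⟩
  have h1 := hY t ht i j
  rwa [clampSymm_eq_self (hYs t ht)
    fun i j => (norm_entry_le_entrywise_sup_norm (Y t)).trans (hsmall t ht).le] at h1

end RiccatiExistence

/-! ### Negative definite matrices and Schur complements. -/

section NegativeDefinite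

variable {m n : Type*} [Fintype m] [Fintype n] [DecidableEq n]

omit [Fintype n] [DecidableEq n] in
theorem NegDef.isSymm {X : Matrix n n ℝ} (hX : NegDef X) : X.IsSymm := by
  simpa using (isHermitian_iff_isSymm.1 hX.isHermitian).neg

theorem NegDef.isUnit {X : Matrix n n ℝ} (hX : NegDef X) : IsUnit X := by
  simpa using (PosDef.isUnit hX).neg

theorem NegDef.neg_inv_posDef {X : Matrix n n ℝ} (hX : NegDef X) : (-X⁻¹).PosDef := by
  have h : (-X)⁻¹ = -X⁻¹ := inv_eq_right_inv (by
    rw [neg_mul_neg, mul_nonsing_inv _ ((isUnit_iff_isUnit_det _).1 hX.isUnit)])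
  exact h ▸ PosDef.inv hX

omit [DecidableEq n] in
theorem negDef_iff_of_isSymm {X : Matrix n n ℝ} (hX : X.IsSymm) :
    NegDef X ↔ ∀ x, x ≠ 0 → x ⬝ᵥ (X *ᵥ x) < 0 := by
  rw [NegDef, posDef_iff_dotProduct_mulVec]
  constructor
  · intro h x hx
    simpa [neg_mulVec] using h.2 hx
  · exact fun h => ⟨isHermitian_iff_isSymm.2 hX.neg, fun x hx => by
      simpa [neg_mulVec] using h x hx⟩

/-- Negative definiteness of a block matrix in terms of its Schur complement. -/
theorem negDef_fromBlocks_iff {X : Matrix m m ℝ} {B : Matrix m n ℝ} {R : Matrix n n ℝ}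
    (hX : X.IsSymm) (hR : NegDef R) :
    NegDef (fromBlocks X B Bᵀ R) ↔ ∀ x, x ≠ 0 → x ⬝ᵥ ((X - B * R⁻¹ * Bᵀ) *ᵥ x) < 0 := by
  have : Invertible R := hR.isUnit.invertible
  have hRs := (negDef_iff_of_isSymm hR.isSymm).1 hR
  have hS := fun x y => schur_complement_eq₂₂ X B x y (isHermitian_iff_isSymm.2 hR.isSymm)
  simp only [conjTranspose_eq_transpose_of_trivial, star_trivial, ← dotProduct_mulVec] at hS
  rw [negDef_iff_of_isSymm (IsSymm.fromBlocks hX (by simp) hR.isSymm)]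
  constructor
  · intro h x hx
    -- This second component annihilates the completed square and leaves only the Schur complement.
    have h1 := h (Sum.elim x (-((R⁻¹ * Bᵀ) *ᵥ x))) fun h0 => hx (by
      ext i
      exact congrFun h0 (Sum.inl i))
    rwa [hS, add_neg_cancel, zero_dotProduct, zero_add] at h1
  · intro h z hz
    rw [← Sum.elim_comp_inl_inr z, hS]
    rcases eq_or_ne (z ∘ Sum.inl) 0 with hx | hx
    · have hy : z ∘ Sum.inr ≠ 0 := fun hy => hz (by
        rw [← Sum.elim_comp_inl_inr z, hx, hy]
        ext (i | i) <;> rfl)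
      simpa [hx] using hRs _ hy
    · refine add_neg_of_nonpos_of_neg ?_ (h _ hx)
      rcases eq_or_ne ((R⁻¹ * Bᵀ) *ᵥ (z ∘ Sum.inl) + z ∘ Sum.inr) 0 with hy | hy
      · rw [hy, zero_dotProduct]
      · exact (hRs _ hy).le

/-- Expanding the quadratic term brings the control Riccati expression to the form
`riccatiMap`. -/
theorem lyapunov_sub_eq_riccatiMap {A Q Y : Matrix m m ℝ} {B S : Matrix m n ℝ}
    {R : Matrix n n ℝ} (hY : Y.IsSymm) (hR : R.IsSymm) :
    Aᵀ * Y + Y * A + Q - (Y * B + S) * R⁻¹ * (Y * B + S)ᵀ =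
      riccatiMap (A - B * R⁻¹ * Sᵀ) (Q - S * R⁻¹ * Sᵀ) (B * (-R⁻¹) * Bᵀ) Y := by
  have hRi : (R⁻¹)ᵀ = R⁻¹ := by rw [transpose_nonsing_inv, hR.eq]
  simp only [riccatiMap, transpose_add, transpose_sub, transpose_mul, transpose_transpose, hY.eq,
    hRi, Matrix.mul_add, Matrix.add_mul, Matrix.mul_sub, Matrix.sub_mul, Matrix.mul_assoc,
    Matrix.neg_mul, Matrix.mul_neg]
  abel

end NegativeDefinite

/-! ### Strict supersolutions near a solution. -/

section StrictSupersolution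

variable {n : Type*} [Fintype n] [DecidableEq n]

/-- Small exponentially weighted multiples of the identity turn a solution of a Riccati equation
into strict supersolutions. -/
theorem exists_riccati_strict_supersolution {F H N Y : ℝ → Matrix n n ℝ} {T : ℝ}
    (hF : ContinuousOn F (Icc 0 T)) (hNc : ContinuousOn N (Icc 0 T))
    (hN : ∀ t ∈ Icc 0 T, (N t).IsSymm)
    (hYs : ∀ t ∈ Icc 0 T, (Y t).IsSymm) (hYc : ContinuousOn Y (Icc 0 T)) :
    ∃ k δ : ℝ, 0 < δ ∧ ∀ ε ∈ Ioo 0 δ, ∀ t ∈ Icc 0 T, ∀ x, x ≠ 0 →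
      x ⬝ᵥ ((-riccatiMap (F t) (H t) (N t) (Y t) -
          (k * (ε * Real.exp (k * (T - t)))) • (1 : Matrix n n ℝ) +
        riccatiMap (F t) (H t) (N t)
          (Y t + (ε * Real.exp (k * (T - t))) • (1 : Matrix n n ℝ))) *ᵥ x) < 0 := by
  have hA : ContinuousOn (fun t => F t + N t * Y t) (Icc 0 T) := hF.add (hNc.mul hYc)
  obtain ⟨f, hf0, hf⟩ := exists_abs_dotProduct_mulVec_le isCompact_Icc
    (X := fun t => (F t + N t * Y t)ᵀ + (F t + N t * Y t))
    ((continuous_id.matrix_transpose.comp_continuousOn hA).add hA)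
  obtain ⟨ν, hν0, hν⟩ := exists_abs_dotProduct_mulVec_le isCompact_Icc hNc
  -- The form is at most `φ |x|² (f + φ ν - k)`. With `k = f + 1` it is negative once `φ ν < 1`,
  -- which the choice of `δ` ensures; `ν + 1` avoids dividing by zero.
  refine ⟨f + 1, 1 / (Real.exp ((f + 1) * T) * (ν + 1)), by positivity,
    fun ε hε t ht x hx => ?_⟩
  have hφ : 0 < ε * Real.exp ((f + 1) * (T - t)) := mul_pos hε.1 (Real.exp_pos _)
  have hφ1 : ε * Real.exp ((f + 1) * (T - t)) * (ν + 1) < 1 := by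
    have h1 : ε * Real.exp ((f + 1) * (T - t)) ≤ ε * Real.exp ((f + 1) * T) :=
      mul_le_mul_of_nonneg_left (Real.exp_le_exp.2
        (mul_le_mul_of_nonneg_left (by linarith [ht.1]) (by positivity))) hε.1.le
    have h2 := (lt_div_iff₀ (by positivity)).1 hε.2
    nlinarith [mul_le_mul_of_nonneg_right h1 (by positivity : 0 ≤ ν + 1)]
  generalize ε * Real.exp ((f + 1) * (T - t)) = φ at hφ hφ1 ⊢
  have h1 := riccatiMap_sub (F := F t) (H := H t) (P := Y t + φ • (1 : Matrix n n ℝ)) (hN t ht)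
    (hYs t ht)
  rw [sub_eq_iff_eq_add] at h1
  have h2 := (abs_le.1 (hf t ht x)).2
  have h3 := (abs_le.1 (hν t ht x)).2
  have hxx := dotProduct_self_pos_of_ne_zero hx
  rw [h1]
  simp only [add_sub_cancel_left, Matrix.mul_smul, Matrix.smul_mul, Matrix.mul_one,
    Matrix.one_mul, ← smul_add, add_mulVec, sub_mulVec, neg_mulVec, smul_mulVec, one_mulVec,
    dotProduct_add, dotProduct_sub, dotProduct_neg, dotProduct_smul, smul_eq_mul] at h2 ⊢
  nlinarith [mul_le_mul_of_nonneg_left h2 hφ.le,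
    mul_le_mul_of_nonneg_left h3 (mul_pos hφ hφ).le, mul_pos hφ hxx,
    mul_lt_mul_of_pos_right hφ1 (mul_pos hφ hxx), mul_pos hφ (mul_pos hφ hxx)]

end StrictSupersolution

/-! ### Continuity of the Riccati coefficients. -/

section Continuity

theorem continuousOn_matrix_inv {n : Type*} [Fintype n] [DecidableEq n]
    {R : ℝ → Matrix n n ℝ} {s : Set ℝ} (hR : ContinuousOn R s) (hu : ∀ t ∈ s, IsUnit (R t)) :
    ContinuousOn (fun t => (R t)⁻¹) s := by
  intro t ht
  have hdet : IsUnit (R t).det := (isUnit_iff_isUnit_det _).1 (hu t ht)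
  have h : ContinuousAt Ring.inverse (R t).det := by
    rw [Ring.inverse_eq_inv']
    exact continuousAt_inv₀ hdet.ne_zero
  exact (continuousAt_matrix_inv (R t) h).comp_continuousWithinAt (hR t ht)

theorem continuousOn_mul_inv_mul_transpose {m n p : Type*} [Fintype n] [DecidableEq n]
    {X : ℝ → Matrix m n ℝ} {Z : ℝ → Matrix p n ℝ} {R : ℝ → Matrix n n ℝ} {s : Set ℝ}
    (hX : ContinuousOn X s) (hZ : ContinuousOn Z s) (hR : ContinuousOn R s)
    (hu : ∀ t ∈ s, IsUnit (R t)) : ContinuousOn (fun t => X t * (R t)⁻¹ * (Z t)ᵀ) s := by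
  have hRi := continuousOn_matrix_inv hR hu
  rw [continuousOn_iff_continuous_domRestrict] at hX hZ hRi ⊢
  exact (hX.matrix_mul hRi).matrix_mul hZ.matrix_transpose

end Continuity

/-! ### Entrywise one-sided derivatives. -/

section TimeDerivative

variable {nx : ℕ} {T : ℝ} {P : ℝ → Matrix (AugIdx nx) (AugIdx nx) ℝ}

theorem IsDiffSymm.hasDerivWithinAt (hP : IsDiffSymm T P) {t : ℝ} (ht : t ∈ Icc 0 T)
    (i j : AugIdx nx) :
    HasDerivWithinAt (fun s => P s i j) (timeDeriv T P t i j) (Icc 0 T) t :=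
  (hP.2 i j t ht).hasDerivWithinAt

theorem IsDiffSymm.timeDeriv_isSymm (hP : IsDiffSymm T P) {t : ℝ} (ht : t ∈ Icc 0 T) :
    (timeDeriv T P t).IsSymm := by
  ext i j
  exact derivWithin_congr (fun s hs => (hP.1 s hs).apply i j) ((hP.1 t ht).apply i j)

theorem timeDeriv_eq (hT : 0 < T) {P' : Matrix (AugIdx nx) (AugIdx nx) ℝ} {t : ℝ}
    (ht : t ∈ Icc 0 T)
    (h : ∀ i j, HasDerivWithinAt (fun s => P s i j) (P' i j) (Icc 0 T) t) :
    timeDeriv T P t = P' := by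
  ext i j
  exact (h i j).derivWithin (uniqueDiffOn_Icc hT t ht)

end TimeDerivative

/-! ### From the matrix inequality to the Riccati equation. -/

namespace LTVSystem

variable {nx nw nv ne m : ℕ} (G : LTVSystem nx nw nv ne)
  (M : Fin m → Matrix (Fin nv ⊕ Fin nw) (Fin nv ⊕ Fin nw) ℝ) (T : ℝ) (lam : Fin m → ℝ)

/-- The drift of the Riccati equation after expanding its quadratic term. -/
noncomputable def riccatiDrift (t : ℝ) : Matrix (AugIdx nx) (AugIdx nx) ℝ :=
  G.Aa t - G.Ba t * (G.R M t lam)⁻¹ * (G.S M t lam)ᵀ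

/-- The constant term of the Riccati equation after expanding its quadratic term. -/
noncomputable def riccatiConst (t : ℝ) : Matrix (AugIdx nx) (AugIdx nx) ℝ :=
  G.Q M t lam - G.S M t lam * (G.R M t lam)⁻¹ * (G.S M t lam)ᵀ

/-- The quadratic coefficient of the Riccati equation. -/
noncomputable def riccatiQuad (t : ℝ) : Matrix (AugIdx nx) (AugIdx nx) ℝ :=
  G.Ba t * (-(G.R M t lam)⁻¹) * (G.Ba t)ᵀ

variable {G M T lam}

theorem QSR_isSymm (hM : ∀ i, (M i).IsSymm) (t : ℝ) : (G.QSR M t lam).IsSymm := by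
  simp only [QSR, IsSymm, transpose_add, transpose_mul, transpose_transpose, transpose_sum,
    transpose_smul, (hM _).eq, Matrix.mul_assoc]

theorem Q_isSymm (hM : ∀ i, (M i).IsSymm) (t : ℝ) : (G.Q M t lam).IsSymm := by
  ext i j
  exact (QSR_isSymm hM t).apply _ _

theorem DLMI_eq_fromBlocks (hM : ∀ i, (M i).IsSymm)
    {P : ℝ → Matrix (AugIdx nx) (AugIdx nx) ℝ} {t : ℝ} (hP : (P t).IsSymm) :
    G.DLMI M T t P lam =
      fromBlocks (timeDeriv T P t + ((G.Aa t)ᵀ * P t + P t * G.Aa t + G.Q M t lam))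
        (P t * G.Ba t + G.S M t lam) (P t * G.Ba t + G.S M t lam)ᵀ (G.R M t lam) := by
  have h21 : (G.QSR M t lam).toBlocks₂₁ = (G.S M t lam)ᵀ := by
    ext i j
    exact (QSR_isSymm hM t).apply _ _
  have h : G.QSR M t lam =
      fromBlocks (G.Q M t lam) (G.S M t lam) (G.S M t lam)ᵀ (G.R M t lam) := by
    rw [← h21]
    exact (fromBlocks_toBlocks _).symm
  rw [DLMI, add_assoc]
  change _ + G.QSR M t lam = _
  rw [h, fromBlocks_add]
  simp only [transpose_add, transpose_mul, hP.eq, zero_add, add_assoc]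

/-- The Schur complement of the `R` block is the Riccati expression, so feasibility becomes a strict
supersolution property. -/
theorem negDef_DLMI_iff (hM : ∀ i, (M i).IsSymm) {P : ℝ → Matrix (AugIdx nx) (AugIdx nx) ℝ}
    (hP : IsDiffSymm T P) {t : ℝ} (ht : t ∈ Icc 0 T) (hR : NegDef (G.R M t lam)) :
    NegDef (G.DLMI M T t P lam) ↔ ∀ x, x ≠ 0 → x ⬝ᵥ ((timeDeriv T P t +
      riccatiMap (G.riccatiDrift M lam t) (G.riccatiConst M lam t) (G.riccatiQuad M lam t)
        (P t)) *ᵥ x) < 0 := by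
  have hPt := hP.1 t ht
  have hX : (timeDeriv T P t + ((G.Aa t)ᵀ * P t + P t * G.Aa t + G.Q M t lam)).IsSymm := by
    simp only [IsSymm, transpose_add, transpose_mul, transpose_transpose, hPt.eq,
      (hP.timeDeriv_isSymm ht).eq, (Q_isSymm hM t).eq]
    abel
  rw [DLMI_eq_fromBlocks hM hPt, negDef_fromBlocks_iff hX hR, add_sub_assoc,
    lyapunov_sub_eq_riccatiMap hPt hR.isSymm]
  rfl

theorem RDE_eq_zero_iff {Y : ℝ → Matrix (AugIdx nx) (AugIdx nx) ℝ} {t : ℝ}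
    (hY : (Y t).IsSymm) (hR : NegDef (G.R M t lam)) :
    G.RDE M T t Y lam = 0 ↔ timeDeriv T Y t =
      -riccatiMap (G.riccatiDrift M lam t) (G.riccatiConst M lam t) (G.riccatiQuad M lam t)
        (Y t) := by
  rw [RDE, add_assoc, add_assoc, add_sub_assoc, ← add_assoc (_ᵀ * _),
    lyapunov_sub_eq_riccatiMap hY hR.isSymm, add_eq_zero_iff_eq_neg]
  rfl

theorem riccatiConst_isSymm (hM : ∀ i, (M i).IsSymm) {t : ℝ} (hR : NegDef (G.R M t lam)) :
    (G.riccatiConst M lam t).IsSymm := by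
  have hRi : ((G.R M t lam)⁻¹)ᵀ = (G.R M t lam)⁻¹ := by
    rw [transpose_nonsing_inv, hR.isSymm.eq]
  simp only [riccatiConst, IsSymm, transpose_sub, transpose_mul, transpose_transpose,
    (Q_isSymm hM t).eq, hRi, Matrix.mul_assoc]

theorem riccatiQuad_posSemidef {t : ℝ} (hR : NegDef (G.R M t lam)) :
    (G.riccatiQuad M lam t).PosSemidef := by
  rw [riccatiQuad, ← conjTranspose_eq_transpose_of_trivial]
  exact hR.neg_inv_posDef.posSemidef.mul_mul_conjTranspose_same (G.Ba t)

theorem continuousOn_riccatiQuad (hB : ContinuousOn G.Ba (Icc 0 T))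
    (hR : ContinuousOn (fun t => G.R M t lam) (Icc 0 T))
    (hRneg : ∀ t ∈ Icc 0 T, NegDef (G.R M t lam)) :
    ContinuousOn (G.riccatiQuad M lam) (Icc 0 T) := by
  have h := (continuousOn_mul_inv_mul_transpose hB hB hR fun t ht => (hRneg t ht).isUnit).neg
  refine h.congr fun t _ => ?_
  simp [riccatiQuad]

/-- Every feasible function dominates every solution of the Riccati equation. -/
theorem Feasible.dotProduct_le (hM : ∀ i, (M i).IsSymm) (hT : 0 < T)
    (hF : ContinuousOn (G.riccatiDrift M lam) (Icc 0 T))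
    (hN : ContinuousOn (G.riccatiQuad M lam) (Icc 0 T))
    (hRneg : ∀ t ∈ Icc 0 T, NegDef (G.R M t lam))
    {P Y : ℝ → Matrix (AugIdx nx) (AugIdx nx) ℝ} (hP : G.Feasible M T lam P)
    (hY : IsDiffSymm T Y) (hYT : Y T = 0) (hRDE : ∀ t ∈ Icc 0 T, G.RDE M T t Y lam = 0)
    (x : AugIdx nx → ℝ) : x ⬝ᵥ (Y 0 *ᵥ x) ≤ x ⬝ᵥ (P 0 *ᵥ x) := by
  obtain ⟨hPd, hPT, hPneg⟩ := hP
  have h := riccati_posSemidef_sub (H := G.riccatiConst M lam) hF hN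
    (fun t ht => riccatiQuad_posSemidef (hRneg t ht)) hPd.1 hY.1
    (fun t ht => hPd.hasDerivWithinAt ht)
    (fun t ht i j => by
      rw [← (RDE_eq_zero_iff (hY.1 t ht) (hRneg t ht)).1 (hRDE t ht)]
      exact hY.hasDerivWithinAt ht i j)
    (fun t ht x => by
      rcases eq_or_ne x 0 with rfl | hx
      · simp
      · exact ((negDef_DLMI_iff hM hPd ht (hRneg t ht)).1 (hPneg t ht) x hx).le)
    (by simpa [hYT] using hPT) 0 (left_mem_Icc.2 hT.le)
  have h1 := h.dotProduct_mulVec_nonneg x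
  simpa [sub_mulVec] using h1

/-- Near a solution of the Riccati equation there are feasible functions. -/
theorem exists_feasible_near (hM : ∀ i, (M i).IsSymm) (hT : 0 < T)
    (hF : ContinuousOn (G.riccatiDrift M lam) (Icc 0 T))
    (hN : ContinuousOn (G.riccatiQuad M lam) (Icc 0 T))
    (hRneg : ∀ t ∈ Icc 0 T, NegDef (G.R M t lam))
    {Y : ℝ → Matrix (AugIdx nx) (AugIdx nx) ℝ}
    (hY : IsDiffSymm T Y) (hYT : Y T = 0) (hRDE : ∀ t ∈ Icc 0 T, G.RDE M T t Y lam = 0) :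
    ∃ c δ : ℝ, 0 < δ ∧ ∀ ε ∈ Ioo 0 δ, ∃ P, G.Feasible M T lam P ∧
      P 0 = Y 0 + (ε * c) • (1 : Matrix (AugIdx nx) (AugIdx nx) ℝ) := by
  have hYc : ContinuousOn Y (Icc 0 T) :=
    continuousOn_pi.2 fun i => continuousOn_pi.2 fun j => (hY.2 i j).continuousOn
  obtain ⟨k, δ, hδ, h⟩ := exists_riccati_strict_supersolution (H := G.riccatiConst M lam) hF hN
    (fun t ht => isHermitian_iff_isSymm.1 (riccatiQuad_posSemidef (hRneg t ht)).isHermitian)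
    hY.1 hYc
  refine ⟨Real.exp (k * (T - 0)), δ, hδ, fun ε hε =>
    ⟨fun t => Y t + (ε * Real.exp (k * (T - t))) • (1 : Matrix (AugIdx nx) (AugIdx nx) ℝ), ?_, rfl⟩⟩
  have hd : ∀ t ∈ Icc 0 T, ∀ i j, HasDerivWithinAt (fun s => (Y s + (ε * Real.exp (k * (T - s))) •
      (1 : Matrix (AugIdx nx) (AugIdx nx) ℝ)) i j)
      ((timeDeriv T Y t - (k * (ε * Real.exp (k * (T - t)))) •
        (1 : Matrix (AugIdx nx) (AugIdx nx) ℝ)) i j) (Icc 0 T) t := fun t ht i j =>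
    hasDerivWithinAt_add_exp_smul_one ε k T i j (hY.hasDerivWithinAt ht i j)
  have hPd : IsDiffSymm T fun t =>
      Y t + (ε * Real.exp (k * (T - t))) • (1 : Matrix (AugIdx nx) (AugIdx nx) ℝ) :=
    ⟨fun t ht => (hY.1 t ht).add (isSymm_one.smul _),
      fun i j t ht => (hd t ht i j).differentiableWithinAt⟩
  refine ⟨hPd, ?_, fun t ht => (negDef_DLMI_iff hM hPd ht (hRneg t ht)).2 fun x hx => ?_⟩
  · simpa [hYT] using PosSemidef.one.smul hε.1.le
  · rw [timeDeriv_eq hT ht (hd t ht), (RDE_eq_zero_iff (hY.1 t ht) (hRneg t ht)).1 (hRDE t ht)]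
    exact h ε hε t ht x hx

/-- `J` is less than `+∞` exactly when there is a feasible function. -/
theorem mem_domJ_iff : lam ∈ G.domJ M T ↔ ∃ P, G.Feasible M T lam P := by
  simp [domJ, J, iInf_lt_iff, EReal.coe_lt_top]

end LTVSystem

/-! ### The equivalences and the value of `J`. -/

theorem theorem2 {nx nw nv ne m : ℕ} (G : LTVSystem nx nw nv ne)
    (M : Fin m → Matrix (Fin nv ⊕ Fin nw) (Fin nv ⊕ Fin nw) ℝ)
    (hM : ∀ i, (M i).IsSymm) (T : ℝ) (hT : 0 < T) (lam : Fin m → ℝ)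
    (hA : ContinuousOn G.Aa (Set.Icc 0 T))
    (hB : ContinuousOn G.Ba (Set.Icc 0 T))
    (hQ : ContinuousOn (fun t => G.Q M t lam) (Set.Icc 0 T))
    (hR : ContinuousOn (fun t => G.R M t lam) (Set.Icc 0 T))
    (hS : ContinuousOn (fun t => G.S M t lam) (Set.Icc 0 T))
    (hRneg : ∀ t ∈ Set.Icc 0 T, NegDef (G.R M t lam)) :
    [lam ∈ G.domJ M T,
      ∃ P : ℝ → Matrix (AugIdx nx) (AugIdx nx) ℝ,
        IsDiffSymm T P ∧ (P T).PosSemidef ∧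
          ∀ t ∈ Set.Icc 0 T, NegDef (G.DLMI M T t P lam),
      ∃ Y : ℝ → Matrix (AugIdx nx) (AugIdx nx) ℝ,
        IsDiffSymm T Y ∧ Y T = 0 ∧
          ∀ t ∈ Set.Icc 0 T, G.RDE M T t Y lam = 0].TFAE ∧
    ∀ Y : ℝ → Matrix (AugIdx nx) (AugIdx nx) ℝ,
      IsDiffSymm T Y → Y T = 0 → (∀ t ∈ Set.Icc 0 T, G.RDE M T t Y lam = 0) →
        G.J M T lam =
          ((augInit nx ⬝ᵥ (Y 0 *ᵥ augInit nx) : ℝ) : EReal) := by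
  have hu : ∀ t ∈ Set.Icc 0 T, IsUnit (G.R M t lam) := fun t ht => (hRneg t ht).isUnit
  have hF : ContinuousOn (G.riccatiDrift M lam) (Set.Icc 0 T) :=
    hA.sub (continuousOn_mul_inv_mul_transpose hB hS hR hu)
  have hH : ContinuousOn (G.riccatiConst M lam) (Set.Icc 0 T) :=
    hQ.sub (continuousOn_mul_inv_mul_transpose hS hS hR hu)
  have hN : ContinuousOn (G.riccatiQuad M lam) (Set.Icc 0 T) :=
    LTVSystem.continuousOn_riccatiQuad hB hR hRneg
  refine ⟨?_, fun Y hY hYT hRDE => le_antisymm ?_ ?_⟩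
  · tfae_have 1 ↔ 2 := LTVSystem.mem_domJ_iff
    tfae_have 2 → 3 := by
      rintro ⟨P, hPd, hPT, hPneg⟩
      obtain ⟨Y, hYs, hYT, hY⟩ := exists_riccati_solution hT.le hF hH hN
        (fun t ht => LTVSystem.riccatiConst_isSymm hM (hRneg t ht))
        (fun t ht => LTVSystem.riccatiQuad_posSemidef (hRneg t ht)) hPd.1
        (fun t ht => hPd.hasDerivWithinAt ht)
        (fun t ht x => by
          rcases eq_or_ne x 0 with rfl | hx
          · simp
          · exact ((LTVSystem.negDef_DLMI_iff hM hPd ht (hRneg t ht)).1 (hPneg t ht) x hx).le)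
        hPT
      exact ⟨Y, ⟨hYs, fun i j t ht => (hY t ht i j).differentiableWithinAt⟩, hYT, fun t ht =>
        (LTVSystem.RDE_eq_zero_iff (hYs t ht) (hRneg t ht)).2 (timeDeriv_eq hT ht (hY t ht))⟩
    tfae_have 3 → 2 := by
      rintro ⟨Y, hY, hYT, hRDE⟩
      obtain ⟨c, δ, hδ, h⟩ := LTVSystem.exists_feasible_near hM hT hF hN hRneg hY hYT hRDE
      obtain ⟨P, hP, -⟩ := h (δ / 2) ⟨half_pos hδ, half_lt_self hδ⟩
      exact ⟨P, hP⟩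
    tfae_finish
  · obtain ⟨c, δ, hδ, h⟩ := LTVSystem.exists_feasible_near hM hT hF hN hRneg hY hYT hRDE
    -- The infimum need not be attained, so the upper bound comes from feasible functions whose
    -- values tend to that of `Y`.
    have key : ∀ ε ∈ Ioo 0 δ, G.J M T lam ≤
        ((augInit nx ⬝ᵥ (Y 0 *ᵥ augInit nx) +
          ε * (c * (augInit nx ⬝ᵥ augInit nx)) : ℝ) : EReal) := by
      intro ε hε
      obtain ⟨P, hP, hP0⟩ := h ε hε
      refine (iInf₂_le P hP).trans_eq ?_
      simp only [hP0, add_mulVec, smul_mulVec, one_mulVec, dotProduct_add, dotProduct_smul,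
        smul_eq_mul, mul_assoc]
    have hlim : Filter.Tendsto (fun ε : ℝ => ((augInit nx ⬝ᵥ (Y 0 *ᵥ augInit nx) +
        ε * (c * (augInit nx ⬝ᵥ augInit nx)) : ℝ) : EReal)) (nhdsWithin 0 (Ioi 0))
        (nhds ((augInit nx ⬝ᵥ (Y 0 *ᵥ augInit nx) : ℝ) : EReal)) := by
      refine Filter.Tendsto.mono_left ?_ nhdsWithin_le_nhds
      have hc : Continuous fun ε : ℝ => ((augInit nx ⬝ᵥ (Y 0 *ᵥ augInit nx) +
          ε * (c * (augInit nx ⬝ᵥ augInit nx)) : ℝ) : EReal) :=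
        continuous_coe_real_ereal.comp (by fun_prop)
      simpa using hc.tendsto 0
    exact ge_of_tendsto hlim (Filter.mem_of_superset (Ioo_mem_nhdsGT hδ) key)
  · exact le_iInf₂ fun P hP => EReal.coe_le_coe_iff.2
      (hP.dotProduct_le hM hT hF hN hRneg hY hYT hRDE _)
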